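/- Let $n\ge 1$ and let $\langle x,y\rangle=-x_0y_0+x_1y_1+\dots+x_ny_n$ on $\mathbb R^{n+1}$. Let $I^n=\{x\in\mathbb R^{n+1}:\langle x,x\rangle=-1,\ x_0>0\}$ be the hyperboloid model of hyperbolic $n$-space, with hyperbolic distance $d_M(x,y)=\operatorname{arcosh}(-\langle x,y\rangle)$, and let $\mathrm{dS}^n=\{u\in\mathbb R^{n+1}:\langle u,u\rangle=1\}$. Let $\Omega$ be the space of totally geodesic hyperplanes of $I^n$, i.e. of the nonempty sets $I^n\cap V$ with $V\subset\mathbb R^{n+1}$ a linear subspace of dimension $n$. The map $u\mapsto P_u=\{x\in I^n:\langle x,u\rangle=0\}$ identifies $\mathrm{dS}^n/\{\pm1\}$ with $\Omega$, and $\Omega$ carries the quotient Borel structure. Let $\mu_0$ be the measure on $\Omega$ that is the image under $u\mapsto P_u$ of the measure $\cosh^{n-1}r\,dr\,d\omega$ on $\mathrm{dS}^n$, in the parametrization $u=(\sinh r,(\cosh r)\,\omega)$, $r\in\mathbb R$, $\omega\in S^{n-1}$, where $d\omega$ is the surface measure of $S^{n-1}$ (counting measure if $n=1$). A hyperplane $H=P_u$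 separates $x$ and $y$ if $\langle x,u\rangle$ and $\langle y,u\rangle$ are nonzero and of opposite signs. For $o,x\in I^n$ let $\Phi_o(x):\Omega\to\mathbb R$ be the indicator function of the set of hyperplanes that separate $x$ and $o$. Then: 1. $d_M$ is a conditionally negative kernel on $I^n$: for every finite set $\{x_1,\dots,x_m\}\subset I^n$ and all real $\lambda_1,\dots,\lambda_m$ with $\sum_i\lambda_i=0$, $$\sum_{i,j}\lambda_i\lambda_j\,d_M(x_i,x_j)\le 0 .$$ 2. There is a constant $c>0$, depending only on $n$, such that for the normalized measure $\mu=c\,\mu_0$ and for every base point $o\in I^n$: $\Phi_o(x)\in L^2(\Omega,\mu)$ for all $x\in I^n$, and for all $x,y\in I^n$ $$d_M(x,y)=\|\Phi_o(x)-\Phi_o(y)\|_{L^2(\Omega,\mu)}^2=\mu\{H\in\Omega: H\text{ separates }x\text{ and }y\}.$$ -/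

import Mathlib

open MeasureTheory
open scoped NNReal ENNReal

namespace HypWalls

/-- The Lorentz form `-x₀y₀ + x₁y₁ + ⋯ + xₙyₙ` on `ℝⁿ⁺¹`. -/
def lorentz {n : ℕ} (x y : Fin (n + 1) → ℝ) : ℝ :=
  -(x 0 * y 0) + ∑ i : Fin n, x i.succ * y i.succ

/-- The hyperboloid model `Iⁿ` of hyperbolic `n`-space. -/
def Hyperboloid (n : ℕ) : Type :=
  {x : Fin (n + 1) → ℝ // lorentz x x = -1 ∧ 0 < x 0}

/-- Hyperbolic distance in the hyperboloid model: `cosh d(x, y) = -⟨x, y⟩`. -/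
noncomputable def hypDist {n : ℕ} (x y : Hyperboloid n) : ℝ :=
  Real.arcosh (-lorentz x.1 y.1)

/-- De Sitter space `dSⁿ`, with the Borel structure it inherits from `ℝⁿ⁺¹`. -/
abbrev DeSitter (n : ℕ) : Type :=
  {u : Fin (n + 1) → ℝ // lorentz u u = 1}

/-- Totally geodesic hyperplanes of `Iⁿ`: the nonempty sections of `Iⁿ` by `n`-dimensional
linear subspaces of `ℝⁿ⁺¹`. -/
def IsHyperplane {n : ℕ} (P : Set (Hyperboloid n)) : Prop :=
  P.Nonempty ∧ ∃ V : Submodule ℝ (Fin (n + 1) → ℝ),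
    Module.finrank ℝ V = n ∧ P = {x : Hyperboloid n | x.1 ∈ V}

/-- The space `Ω` of totally geodesic hyperplanes of `Iⁿ`. -/
def Hyperplane (n : ℕ) : Type := {P : Set (Hyperboloid n) // IsHyperplane P}

/-- `P_u = {x ∈ Iⁿ : ⟨x, u⟩ = 0}`. -/
def perp {n : ℕ} (u : DeSitter n) : Set (Hyperboloid n) :=
  {x | lorentz x.1 u.1 = 0}

theorem isHyperplane_perp {n : ℕ} (u : DeSitter n) : IsHyperplane (perp u) := by
  obtain ⟨u, hu⟩ := u
  have hu' : ∑ i : Fin n, u i.succ * u i.succ = 1 + u 0 * u 0 := by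
    unfold lorentz at hu; linarith
  constructor
  · set s := Real.sqrt (1 + u 0 * u 0) with hs
    have hpos : 0 < 1 + u 0 * u 0 := by nlinarith [mul_self_nonneg (u 0)]
    have hs0 : 0 < s := Real.sqrt_pos.2 hpos
    have hss : s * s = 1 + u 0 * u 0 := Real.mul_self_sqrt hpos.le
    refine ⟨⟨Fin.cons s (fun i => u 0 / s * u i.succ), ?_, ?_⟩, ?_⟩
    · have h : ∑ i : Fin n, (u 0 / s * u i.succ) * (u 0 / s * u i.succ)
          = (u 0 / s) * (u 0 / s) * ∑ i : Fin n, u i.succ * u i.succ := by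
        rw [Finset.mul_sum]; exact Finset.sum_congr rfl fun i _ => by ring
      simp only [lorentz, Fin.cons_zero, Fin.cons_succ]
      rw [h, hu', ← hss]
      field_simp
      nlinarith
    · simpa using hs0
    · have h : ∑ i : Fin n, (u 0 / s * u i.succ) * u i.succ
          = (u 0 / s) * ∑ i : Fin n, u i.succ * u i.succ := by
        rw [Finset.mul_sum]; exact Finset.sum_congr rfl fun i _ => by ring
      change lorentz _ u = 0
      simp only [lorentz, Fin.cons_zero, Fin.cons_succ]
      rw [h, hu', ← hss]
      field_simp
      ring
  · let f : (Fin (n + 1) → ℝ) →ₗ[ℝ] ℝ :=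
      { toFun := fun x => lorentz x u
        map_add' := fun x y => by
          simp only [lorentz, Pi.add_apply, add_mul, Finset.sum_add_distrib]; ring
        map_smul' := fun a x => by
          simp only [lorentz, Pi.smul_apply, smul_eq_mul, RingHom.id_apply, mul_add,
            Finset.mul_sum, mul_assoc]; ring }
    have hf : f ≠ 0 := fun h => by
      have h1 : f u = 0 := by rw [h]; rfl
      have h2 : f u = 1 := hu
      linarith
    refine ⟨LinearMap.ker f, ?_, rfl⟩
    have h1 := LinearMap.finrank_range_add_finrank_ker f
    rw [LinearMap.range_eq_top.2 (LinearMap.surjective hf), finrank_top] at h1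
    simp at h1
    omega

/-- The map `dSⁿ → Ω`, `u ↦ P_u`; it identifies `Ω` with `dSⁿ / {±1}`. -/
def toHyperplane {n : ℕ} (u : DeSitter n) : Hyperplane n :=
  ⟨perp u, isHyperplane_perp u⟩

/-- The quotient Borel structure on `Ω ≅ dSⁿ / {±1}`. -/
instance instMeasurableSpaceHyperplane (n : ℕ) : MeasurableSpace (Hyperplane n) :=
  MeasurableSpace.map toHyperplane inferInstance

/-- The parametrization `u(r, ω) = (sinh r, (cosh r) ω)` of `dSⁿ` by `ℝ × Sⁿ⁻¹`. -/
noncomputable def polar {n : ℕ}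
    (p : ℝ × Metric.sphere (0 : EuclideanSpace ℝ (Fin n)) 1) : DeSitter n :=
  ⟨Fin.cons (Real.sinh p.1) (fun i => Real.cosh p.1 * p.2.1 i), by
    have h : ∑ i : Fin n, p.2.1 i * p.2.1 i = 1 := by
      have h1 : ‖p.2.1‖ ^ 2 = 1 := by rw [mem_sphere_zero_iff_norm.1 p.2.2]; norm_num
      rw [EuclideanSpace.real_norm_sq_eq] at h1
      simpa [sq] using h1
    have h2 : ∑ i : Fin n, (Real.cosh p.1 * p.2.1 i) * (Real.cosh p.1 * p.2.1 i)
        = Real.cosh p.1 ^ 2 * ∑ i : Fin n, p.2.1 i * p.2.1 i := by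
      rw [Finset.mul_sum]; exact Finset.sum_congr rfl fun i _ => by ring
    simp only [lorentz, Fin.cons_zero, Fin.cons_succ]
    rw [h2, h]
    nlinarith [Real.cosh_sq p.1]⟩

/-- The volume measure `coshⁿ⁻¹ r dr dω` of de Sitter space, `dω` being the surface measure
of the unit sphere `Sⁿ⁻¹` (counting measure if `n = 1`). -/
noncomputable def deSitterMeasure (n : ℕ) : Measure (DeSitter n) :=
  Measure.map polar
    (((volume : Measure ℝ).withDensity fun r => ENNReal.ofReal (Real.cosh r ^ (n - 1))).prod
      (volume : Measure (EuclideanSpace ℝ (Fin n))).toSphere)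

/-- The measure on `Ω` induced by `coshⁿ⁻¹ r dr dω` (not yet normalized). -/
noncomputable def hyperplaneMeasure (n : ℕ) : Measure (Hyperplane n) :=
  Measure.map toHyperplane (deSitterMeasure n)

/-- `H` separates `x` and `y`: writing `H = P_u`, the points `x` and `y` lie in the two opposite
open half-spaces bounded by `H`. (Replacing `u` by `-u` interchanges `x` and `y`.) -/
def Separates {n : ℕ} (H : Hyperplane n) (x y : Hyperboloid n) : Prop :=
  ∃ u : DeSitter n, toHyperplane u = H ∧ lorentz x.1 u.1 < 0 ∧ 0 < lorentz y.1 u.1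

open Classical in
/-- `Φ(x)`, relative to the base point `o`: the indicator function of the set of hyperplanes
separating `x` and `o`. -/
noncomputable def wallMap {n : ℕ} (o x : Hyperboloid n) (H : Hyperplane n) : ℝ :=
  if Separates H x o then 1 else 0

/-- Conditionally negative kernels on a set `V`. -/
def IsCondNegKernel {V : Type*} (f : V → V → ℝ) : Prop :=
  ∀ (s : Finset V) (a : V → ℝ), ∑ v ∈ s, a v = 0 →
    ∑ v ∈ s, ∑ w ∈ s, a v * a w * f v w ≤ 0

end HypWalls

/-!
The heart of the matter is a Crofton formula: the measure of the set of hyperplanes separating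
`x` and `y` is a constant multiple of `hypDist x y`.

The measure `coshⁿ⁻¹ r dr dω` on de Sitter space is, up to the factor `n + 1`, the cone measure:
the volume of a set `A` is the Lebesgue volume of the cone `{s • u | 0 < s < 1, u ∈ A}`
(`deSitterMeasure_eq_volume_cone`). This follows from polar coordinates on the space factor of
`ℝⁿ⁺¹ = ℝ × ℝⁿ` and the substitution `t = ρ tanh r` in the time coordinate. In this form the
invariance of the measure under Lorentz transformations is the invariance of Lebesgue measure
under linear maps of determinant `±1`; only reflections are needed.

Let `V(x, y)` be the volume of `sepCone x y`, the cone of the vectors whose orthogonal hyperplanes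
separate `x` and `y`. It is finite because the cone is bounded. Two reflections carry any pair of
points to any other pair at the same distance, so `V(x, y)` depends on the distance only
(`volume_sepCone_congr`). It is additive along geodesics, since a hyperplane which misses a point
between `x` and `z` separates `x` and `z` precisely if it separates one of them from this point,
and the hyperplanes through a given point form a null set (`volume_sepCone_add`). A nonnegative
additive function on the half-line is linear, and `V(x, y) > 0` for `x ≠ y`, so `V` is a positive
multiple of the distance (`exists_volume_sepCone_eq`).

Outside the null set of hyperplanes through `o`, `x` or `y`, the absolute value of
`wallMap o x - wallMap o y` is the indicator function of the hyperplanes separating `x` and `y`,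
and so the square of its `L²` norm is the measure of this set (`norm_toLp_wallMap_sub_sq`). Thus
the distance is the square of a Hilbert space distance, hence a conditionally negative kernel.
-/

namespace HypWalls

variable {n : ℕ}

/-! ### The Lorentz form and the hyperboloid -/

theorem lorentz_comm (x y : Fin (n + 1) → ℝ) : lorentz x y = lorentz y x := by
  simp only [lorentz, mul_comm]

theorem lorentz_add_left (x y z : Fin (n + 1) → ℝ) :
    lorentz (x + y) z = lorentz x z + lorentz y z := by
  simp only [lorentz, Pi.add_apply, add_mul, Finset.sum_add_distrib]; ring

theorem lorentz_smul_left (a : ℝ) (x y : Fin (n + 1) → ℝ) :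
    lorentz (a • x) y = a * lorentz x y := by
  simp only [lorentz, Pi.smul_apply, smul_eq_mul, mul_add, Finset.mul_sum, mul_assoc]; ring

theorem lorentz_sub_left (x y z : Fin (n + 1) → ℝ) :
    lorentz (x - y) z = lorentz x z - lorentz y z := by
  simp only [lorentz, Pi.sub_apply, sub_mul, Finset.sum_sub_distrib]; ring

theorem lorentz_add_right (x y z : Fin (n + 1) → ℝ) :
    lorentz x (y + z) = lorentz x y + lorentz x z := by
  simp only [lorentz_comm x, lorentz_add_left]

theorem lorentz_smul_right (a : ℝ) (x y : Fin (n + 1) → ℝ) :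
    lorentz x (a • y) = a * lorentz x y := by
  simp only [lorentz_comm x, lorentz_smul_left]

theorem lorentz_sub_right (x y z : Fin (n + 1) → ℝ) :
    lorentz x (y - z) = lorentz x y - lorentz x z := by
  simp only [lorentz_comm x, lorentz_sub_left]

@[fun_prop]
theorem continuous_lorentz (x : Fin (n + 1) → ℝ) : Continuous (lorentz x) := by
  unfold lorentz; fun_prop

@[fun_prop]
theorem continuous_lorentz_self : Continuous fun v : Fin (n + 1) → ℝ => lorentz v v := by
  unfold lorentz; fun_prop

/-- The Cauchy–Schwarz inequality for the space parts of two vectors of norm `-1`. -/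
theorem sq_sub_le_of_lorentz_self {x y : Fin (n + 1) → ℝ} (hx : lorentz x x = -1)
    (hy : lorentz y y = -1) :
    (lorentz x y + x 0 * y 0) ^ 2 ≤ (x 0 ^ 2 - 1) * (y 0 ^ 2 - 1) := by
  have h := Finset.sum_mul_sq_le_sq_mul_sq Finset.univ (fun i : Fin n => x i.succ)
    (fun i => y i.succ)
  simp only [lorentz, ← sq] at hx hy ⊢
  convert! h using 2 <;> linarith

theorem one_le_of_lorentz_self {x : Fin (n + 1) → ℝ} (hx : lorentz x x = -1)
    (h0 : 0 < x 0) : 1 ≤ x 0 := by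
  have : 0 ≤ ∑ i : Fin n, x i.succ * x i.succ :=
    Finset.sum_nonneg fun i _ => mul_self_nonneg _
  simp only [lorentz] at hx
  nlinarith

theorem one_le_neg_lorentz {x y : Fin (n + 1) → ℝ} (hx : lorentz x x = -1) (hx0 : 0 < x 0)
    (hy : lorentz y y = -1) (hy0 : 0 < y 0) : 1 ≤ -lorentz x y := by
  have h := sq_sub_le_of_lorentz_self hx hy
  have h1 := one_le_of_lorentz_self hx hx0
  have h2 := one_le_of_lorentz_self hy hy0
  have : lorentz x y + x 0 * y 0 ≤ x 0 * y 0 - 1 :=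
    le_of_abs_le (abs_le_of_sq_le_sq (by nlinarith [sq_nonneg (x 0 - y 0)]) (by nlinarith))
  linarith

theorem lorentz_sub_self {x y : Fin (n + 1) → ℝ} (hx : lorentz x x = -1)
    (hy : lorentz y y = -1) : lorentz (x - y) (x - y) = -2 - 2 * lorentz x y := by
  rw [lorentz_sub_left, lorentz_sub_right, lorentz_sub_right, hx, hy, lorentz_comm y x]; ring

theorem eq_of_lorentz_sub_self {x y : Fin (n + 1) → ℝ} (hx : lorentz x x = -1)
    (hy : lorentz y y = -1) (h : lorentz (x - y) (x - y) = 0) : x = y := by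
  have h1 : lorentz x y = -1 := by linarith [lorentz_sub_self hx hy]
  have h2 := sq_sub_le_of_lorentz_self hx hy
  have h0 : x 0 - y 0 = 0 := by
    rw [h1] at h2
    exact pow_eq_zero_iff two_ne_zero |>.1 (le_antisymm (by nlinarith) (sq_nonneg (x 0 - y 0)))
  have hs : ∑ i : Fin n, (x i.succ - y i.succ) * (x i.succ - y i.succ) = 0 := by
    simpa [lorentz, h0] using h
  rw [Finset.sum_eq_zero_iff_of_nonneg fun i _ => mul_self_nonneg _] at hs
  ext i
  refine Fin.cases (sub_eq_zero.1 h0) (fun j => ?_) i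
  exact sub_eq_zero.1 (mul_self_eq_zero.1 (hs j (Finset.mem_univ _)))

/-! ### Lorentz reflections -/

/-- The Lorentz reflection in the hyperplane orthogonal to `w`; since `a / 0 = 0`, it is the
identity if `w` is isotropic. -/
noncomputable def reflection (w : Fin (n + 1) → ℝ) :
    (Fin (n + 1) → ℝ) →ₗ[ℝ] (Fin (n + 1) → ℝ) where
  toFun v := v - (2 * lorentz v w / lorentz w w) • w
  map_add' a b := by
    rw [lorentz_add_left]; module
  map_smul' a b := by
    rw [lorentz_smul_left, RingHom.id_apply]; module

theorem reflection_apply (w v : Fin (n + 1) → ℝ) :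
    reflection w v = v - (2 * lorentz v w / lorentz w w) • w := rfl

theorem lorentz_reflection (w u v : Fin (n + 1) → ℝ) :
    lorentz (reflection w u) (reflection w v) = lorentz u v := by
  simp only [reflection_apply, lorentz_sub_left, lorentz_sub_right, lorentz_smul_left,
    lorentz_smul_right, lorentz_comm w v]
  by_cases h : lorentz w w = 0
  · simp [h]
  · field_simp; ring

theorem reflection_comp_self (w : Fin (n + 1) → ℝ) :
    reflection w ∘ₗ reflection w = LinearMap.id := by
  ext1 i
  ext1
  simp only [LinearMap.comp_apply, LinearMap.id_apply]
  generalize LinearMap.single ℝ (fun _ : Fin (n + 1) => ℝ) i 1 = v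
  rw [reflection_apply w (reflection w v), reflection_apply w v, lorentz_sub_left,
    lorentz_smul_left]
  by_cases h : lorentz w w = 0
  · simp [h]
  · rw [sub_sub, ← add_smul]
    have : 2 * lorentz v w / lorentz w w
        + 2 * (lorentz v w - 2 * lorentz v w / lorentz w w * lorentz w w) / lorentz w w = 0 := by
      field_simp; ring
    rw [this, zero_smul, sub_zero]

theorem abs_det_reflection (w : Fin (n + 1) → ℝ) : |LinearMap.det (reflection w)| = 1 := by
  have h := congrArg LinearMap.det (reflection_comp_self w)
  rw [LinearMap.det_comp, LinearMap.det_id] at h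
  rcases mul_self_eq_one_iff.1 h with h | h <;> simp [h]

/-- Two points of the hyperboloid are interchanged by the reflection in their perpendicular
bisector. -/
theorem reflection_sub_apply {x y : Fin (n + 1) → ℝ} (hx : lorentz x x = -1)
    (hy : lorentz y y = -1) : reflection (x - y) x = y := by
  by_cases h : lorentz (x - y) (x - y) = 0
  · simp [reflection_apply, eq_of_lorentz_sub_self hx hy h]
  · have : 2 * lorentz x (x - y) = lorentz (x - y) (x - y) := by
      rw [lorentz_sub_self hx hy, lorentz_sub_right, hx]; ring
    rw [reflection_apply, this, div_self h, one_smul, sub_sub_cancel]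

theorem reflection_apply_of_lorentz_eq_zero {w v : Fin (n + 1) → ℝ} (h : lorentz v w = 0) :
    reflection w v = v := by
  simp [reflection_apply, h]

/-! ### The volume of double cones -/

/-- The part of the solid de Sitter cone `0 < ⟨v, v⟩ < 1` formed by the vectors whose orthogonal
hyperplanes separate `x` and `y`. -/
def sepCone (x y : Fin (n + 1) → ℝ) : Set (Fin (n + 1) → ℝ) :=
  {v | (0 < lorentz v v ∧ lorentz v v < 1) ∧ lorentz x v * lorentz y v < 0}

theorem isOpen_sepCone (x y : Fin (n + 1) → ℝ) : IsOpen (sepCone x y) := by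
  have h : Continuous fun v : Fin (n + 1) → ℝ => lorentz v v := continuous_lorentz_self
  exact ((isOpen_lt continuous_const h).inter (isOpen_lt h continuous_const)).inter
    (isOpen_lt ((continuous_lorentz x).mul (continuous_lorentz y)) continuous_const)

/-- The cone is bounded: the hyperplane orthogonal to `v` passes between `x` and `y`, so `v`
is not too close to being isotropic. -/
theorem sepCone_subset_closedBall {x y : Fin (n + 1) → ℝ} (hx : lorentz x x = -1)
    (hx0 : 0 < x 0) (hy : lorentz y y = -1) (hy0 : 0 < y 0) :
    sepCone x y ⊆ Metric.closedBall 0 (x 0 + y 0) := by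
  rintro v ⟨⟨hv, hv1⟩, hxy⟩
  set N := ∑ i : Fin n, v i.succ ^ 2 with hN
  have hvv : lorentz v v = -v 0 ^ 2 + N := by simp [lorentz, hN, sq]
  have key : ∀ p : Fin (n + 1) → ℝ, lorentz p p = -1 → 0 < p 0 →
      (p 0 * v 0) ^ 2 ≤ (∑ i : Fin n, p i.succ * v i.succ) ^ 2 → N ≤ p 0 ^ 2 := by
    intro p hp hp0 hle
    have h := Finset.sum_mul_sq_le_sq_mul_sq Finset.univ (fun i : Fin n => p i.succ)
      (fun i => v i.succ)
    have hp' : ∑ i : Fin n, p i.succ ^ 2 = p 0 ^ 2 - 1 := by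
      simp only [lorentz, ← sq] at hp; linarith
    rw [hp', ← hN] at h
    nlinarith [sq_nonneg (p 0)]
  have hNle : N ≤ (x 0 + y 0) ^ 2 := by
    -- If the time part dominated for both, `⟨x, v⟩` and `⟨y, v⟩` would have the sign of `-v 0`.
    have hcase : (x 0 * v 0) ^ 2 ≤ (∑ i : Fin n, x i.succ * v i.succ) ^ 2 ∨
        (y 0 * v 0) ^ 2 ≤ (∑ i : Fin n, y i.succ * v i.succ) ^ 2 := by
      simp only [lorentz] at hxy
      rw [sq_le_sq, sq_le_sq]
      by_contra! h
      obtain ⟨h1, h2⟩ := h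
      rw [abs_mul, abs_of_pos hx0, abs_lt] at h1
      rw [abs_mul, abs_of_pos hy0, abs_lt] at h2
      rcases le_total 0 (v 0) with h0 | h0
      · rw [abs_of_nonneg h0] at h1 h2
        nlinarith
      · rw [abs_of_nonpos h0] at h1 h2
        nlinarith
    rcases hcase with h | h
    · nlinarith [key x hx hx0 h]
    · nlinarith [key y hy hy0 h]
  have hv0 : v 0 ^ 2 ≤ N := by linarith
  rw [mem_closedBall_zero_iff, pi_norm_le_iff_of_nonneg (by linarith)]
  intro i
  rw [Real.norm_eq_abs]
  refine abs_le_of_sq_le_sq ?_ (by linarith)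
  refine le_trans ?_ hNle
  refine Fin.cases hv0 (fun j => ?_) i
  exact Finset.single_le_sum (f := fun j : Fin n => v j.succ ^ 2) (fun _ _ => sq_nonneg _)
    (Finset.mem_univ j)

theorem volume_sepCone_ne_top {x y : Fin (n + 1) → ℝ} (hx : lorentz x x = -1)
    (hx0 : 0 < x 0) (hy : lorentz y y = -1) (hy0 : 0 < y 0) : volume (sepCone x y) ≠ ∞ :=
  ((measure_mono (sepCone_subset_closedBall hx hx0 hy hy0)).trans_lt
    measure_closedBall_lt_top).ne

theorem volume_sepCone_reflection (w x y : Fin (n + 1) → ℝ) :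
    volume (sepCone (reflection w x) (reflection w y)) = volume (sepCone x y) := by
  have h : sepCone x y = reflection w ⁻¹' sepCone (reflection w x) (reflection w y) := by
    ext v
    simp [sepCone, lorentz_reflection]
  have hd : LinearMap.det (reflection w) ≠ 0 := fun h => by
    simpa [h] using abs_det_reflection w
  rw [h, Measure.addHaar_preimage_linearMap _ hd, abs_inv, abs_det_reflection]
  simp

/-- Two reflections carry any pair of points to any other pair at the same distance, so the
volume depends on the distance only. -/
theorem volume_sepCone_congr {x y x' y' : Fin (n + 1) → ℝ} (hx : lorentz x x = -1)
    (hy : lorentz y y = -1) (hx' : lorentz x' x' = -1) (hy' : lorentz y' y' = -1)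
    (h : lorentz x y = lorentz x' y') :
    volume (sepCone x y) = volume (sepCone x' y') := by
  set z := reflection (x - x') y with hz
  have hzz : lorentz z z = -1 := by rw [hz, lorentz_reflection, hy]
  have hx1 : reflection (x - x') x = x' := reflection_sub_apply hx hx'
  have hxz : lorentz x' z = lorentz x' y' := by
    have := lorentz_reflection (x - x') x y
    rwa [hx1, ← hz, h] at this
  rw [← volume_sepCone_reflection (x - x') x y, hx1, ← hz,
    ← volume_sepCone_reflection (z - y') x' z, reflection_sub_apply hzz hy',
    reflection_apply_of_lorentz_eq_zero (by rw [lorentz_sub_right, hxz, sub_self])]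

theorem volume_lorentz_eq_zero {x : Fin (n + 1) → ℝ} (hx : lorentz x x = -1) :
    volume {v | lorentz x v = 0} = 0 := by
  let f : (Fin (n + 1) → ℝ) →ₗ[ℝ] ℝ :=
    { toFun := lorentz x
      map_add' := lorentz_add_right x
      map_smul' := fun a y => lorentz_smul_right a x y }
  refine Measure.addHaar_submodule volume (LinearMap.ker f) fun h => ?_
  have : f x = 0 := by rw [← LinearMap.mem_ker, h]; trivial
  have : lorentz x x = 0 := this
  linarith

/-- Additivity along a geodesic: a hyperplane not through the intermediate point `y` separates
`x` and `z` if and only if it separates exactly one of them from `y`. -/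
theorem volume_sepCone_add {x y z : Fin (n + 1) → ℝ} {a b c : ℝ} (ha : 0 ≤ a) (hb : 0 ≤ b)
    (hc : 0 < c) (hy : lorentz y y = -1) (h : c • y = a • x + b • z) :
    volume (sepCone x z) = volume (sepCone x y) + volume (sepCone y z) := by
  have hl : ∀ v, c * lorentz y v = a * lorentz x v + b * lorentz z v := fun v => by
    rw [← lorentz_smul_left, h, lorentz_add_left, lorentz_smul_left, lorentz_smul_left]
  have hdisj : Disjoint (sepCone x y) (sepCone y z) := by
    rw [Set.disjoint_left]
    rintro v ⟨-, h1⟩ ⟨-, h2⟩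
    have := hl v
    rcases mul_neg_iff.1 h1 with ⟨h3, h4⟩ | ⟨h3, h4⟩ <;>
    rcases mul_neg_iff.1 h2 with ⟨h5, h6⟩ | ⟨h5, h6⟩ <;> nlinarith
  rw [← measure_union hdisj (isOpen_sepCone _ _).measurableSet]
  refine measure_congr ?_
  have h0 : ∀ᵐ v, lorentz y v ≠ 0 := by
    rw [ae_iff]
    simpa using volume_lorentz_eq_zero hy
  filter_upwards [h0] with v hv
  refine propext ?_
  change v ∈ sepCone x z ↔ v ∈ sepCone x y ∪ sepCone y z
  simp only [sepCone, Set.mem_union, Set.mem_ofPred_eq, ← and_or_left]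
  refine and_congr_right fun _ => ?_
  have := hl v
  constructor
  · intro h1
    rcases mul_neg_iff.1 h1 with ⟨h3, h4⟩ | ⟨h3, h4⟩ <;> rcases hv.lt_or_gt with h5 | h5
    · exact .inl (mul_neg_of_pos_of_neg h3 h5)
    · exact .inr (mul_neg_of_pos_of_neg h5 h4)
    · exact .inr (mul_neg_of_neg_of_pos h5 h4)
    · exact .inl (mul_neg_of_neg_of_pos h3 h5)
  · rintro (h1 | h1)
    · rcases mul_neg_iff.1 h1 with ⟨h3, h4⟩ | ⟨h3, h4⟩
      · refine mul_neg_of_pos_of_neg h3 (by by_contra! h5; nlinarith [mul_nonneg hb h5])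
      · refine mul_neg_of_neg_of_pos h3 (by by_contra! h5; nlinarith [mul_nonneg hb (neg_nonneg.2 h5)])
    · rcases mul_neg_iff.1 h1 with ⟨h3, h4⟩ | ⟨h3, h4⟩
      · refine mul_neg_of_pos_of_neg (by by_contra! h5; nlinarith) h4
      · refine mul_neg_of_neg_of_pos (by by_contra! h5; nlinarith) h4

theorem volume_sepCone_pos {x y : Fin (n + 1) → ℝ} (hx : lorentz x x = -1)
    (hy : lorentz y y = -1) (h : 1 < -lorentz x y) : 0 < volume (sepCone x y) := by
  refine (isOpen_sepCone x y).measure_pos volume ?_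
  set q := -2 - 2 * lorentz x y with hq
  have hq0 : 0 < q := by linarith
  -- The normal `x - y` of the perpendicular bisector, rescaled into the cone.
  refine ⟨(1 / (1 + q)) • (x - y), ⟨?_, ?_⟩, ?_⟩
  · rw [lorentz_smul_left, lorentz_smul_right, lorentz_sub_self hx hy]
    positivity
  · rw [lorentz_smul_left, lorentz_smul_right, lorentz_sub_self hx hy, ← hq]
    field_simp
    nlinarith
  · rw [lorentz_smul_right, lorentz_smul_right, lorentz_sub_right, lorentz_sub_right, hx, hy,
      lorentz_comm y x]
    have : 0 < 1 / (1 + q) := by positivity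
    exact mul_neg_of_pos_of_neg (mul_pos this (by linarith))
      (mul_neg_of_pos_of_neg this (by linarith))

/-! ### Linearity in the distance -/

/-- Cauchy's functional equation on the half-line, for nonnegative functions. -/
theorem eq_mul_of_additive {f : ℝ → ℝ} (hf : ∀ t, 0 ≤ t → 0 ≤ f t)
    (hadd : ∀ s t, 0 ≤ s → 0 ≤ t → f (s + t) = f s + f t) {t : ℝ} (ht : 0 ≤ t) :
    f t = t * f 1 := by
  have hmul : ∀ (k : ℕ) (s : ℝ), 0 ≤ s → f (k * s) = k * f s := by
    intro k s hs
    induction k with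
    | zero => have := hadd 0 0 le_rfl le_rfl; simp at this ⊢; linarith
    | succ k ih =>
      have := hadd (k * s) s (by positivity) hs
      push_cast
      rw [add_mul, one_mul, this, ih]; ring
  have hmono : ∀ s t, 0 ≤ s → s ≤ t → f s ≤ f t := fun s t hs hst => by
    have := hadd s (t - s) hs (by linarith)
    rw [add_sub_cancel] at this
    linarith [hf (t - s) (by linarith)]
  have h1 := hf 1 zero_le_one
  have hbound : ∀ k : ℕ, k * |f t - t * f 1| ≤ f 1 := by
    intro k
    have hkt : 0 ≤ k * t := by positivity
    have e1 := hmul ⌊k * t⌋₊ 1 zero_le_one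
    have e2 := hmul (⌊k * t⌋₊ + 1) 1 zero_le_one
    push_cast at e2
    rw [mul_one] at e1 e2
    have l1 := hmono _ _ (by positivity) (Nat.floor_le hkt)
    have l2 := hmono _ _ hkt (Nat.lt_floor_add_one (k * t)).le
    have l3 := mul_le_mul_of_nonneg_right (Nat.floor_le hkt) h1
    have l4 := mul_le_mul_of_nonneg_right (Nat.lt_floor_add_one (k * t)).le h1
    rw [hmul k t ht] at l1 l2
    have habs : k * |f t - t * f 1| = |k * (f t - t * f 1)| := by rw [abs_mul, Nat.abs_cast]
    rw [habs, abs_le]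
    constructor <;> nlinarith
  by_contra hne
  have hpos : 0 < |f t - t * f 1| := abs_pos.2 (sub_ne_zero.2 hne)
  obtain ⟨k, hk⟩ := exists_nat_gt (f 1 / |f t - t * f 1|)
  rw [div_lt_iff₀ hpos] at hk
  linarith [hbound k]

/-- The unit speed geodesic `t ↦ (cosh t, sinh t, 0, …, 0)`. -/
noncomputable def geodesic (m : ℕ) (t : ℝ) : Fin (m + 1 + 1) → ℝ :=
  Fin.cons (Real.cosh t) (Fin.cons (Real.sinh t) 0)

theorem lorentz_geodesic (m : ℕ) (s t : ℝ) :
    lorentz (geodesic m s) (geodesic m t) = -Real.cosh (t - s) := by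
  simp only [lorentz, geodesic, Fin.cons_zero, Fin.cons_succ, Fin.sum_univ_succ,
    Pi.zero_apply, mul_zero, Finset.sum_const_zero, Real.cosh_sub]
  ring

theorem lorentz_geodesic_self (m : ℕ) (t : ℝ) :
    lorentz (geodesic m t) (geodesic m t) = -1 := by
  simp [lorentz_geodesic]

theorem sinh_smul_geodesic (m : ℕ) (s t : ℝ) :
    Real.sinh (s + t) • geodesic m s
      = Real.sinh t • geodesic m 0 + Real.sinh s • geodesic m (s + t) := by
  ext i
  refine Fin.cases ?_ (fun j => Fin.cases ?_ (fun k => ?_) j) i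
  · simp [geodesic, Real.sinh_add, Real.cosh_add]
    linear_combination Real.sinh t * Real.cosh_sq s
  · simp [geodesic, Real.sinh_add, Real.cosh_add]; ring
  · simp [geodesic]

/-- The volume of `sepCone x y` is a constant multiple of the distance of `x` and `y`. -/
theorem exists_volume_sepCone_eq (hn : 1 ≤ n) :
    ∃ C : ℝ, 0 < C ∧ ∀ x y : Hyperboloid n,
      volume (sepCone x.1 y.1) = ENNReal.ofReal (C * hypDist x y) := by
  obtain ⟨m, rfl⟩ : ∃ m, n = m + 1 := ⟨n - 1, by omega⟩
  have hg0 : ∀ t, 0 < geodesic m t 0 := fun t => Real.cosh_pos t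
  have hfin : ∀ s t, volume (sepCone (geodesic m s) (geodesic m t)) ≠ ∞ := fun s t =>
    volume_sepCone_ne_top (lorentz_geodesic_self m s) (hg0 s) (lorentz_geodesic_self m t) (hg0 t)
  set f : ℝ → ℝ := fun t => (volume (sepCone (geodesic m 0) (geodesic m t))).toReal with hf
  have hadd : ∀ s t, 0 ≤ s → 0 ≤ t → f (s + t) = f s + f t := by
    intro s t hs ht
    have hshift : volume (sepCone (geodesic m 0) (geodesic m t))
        = volume (sepCone (geodesic m s) (geodesic m (s + t))) := by
      refine volume_sepCone_congr ?_ ?_ ?_ ?_ ?_ <;> simp [lorentz_geodesic]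
    simp only [hf]
    rw [hshift, ← ENNReal.toReal_add (hfin _ _) (hfin _ _)]
    rcases (add_nonneg hs ht).eq_or_lt with h0 | h0
    · obtain rfl : s = 0 := by linarith
      obtain rfl : t = 0 := by linarith
      have : sepCone (geodesic m 0) (geodesic m 0) = ∅ := by
        ext v
        simpa [sepCone] using fun _ _ => mul_self_nonneg _
      simp [this]
    · rw [volume_sepCone_add (Real.sinh_nonneg_iff.2 ht) (Real.sinh_nonneg_iff.2 hs)
        (Real.sinh_pos_iff.2 h0) (lorentz_geodesic_self m s) (sinh_smul_geodesic m s t)]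
  have hpos : 0 < f 1 := by
    refine ENNReal.toReal_pos (volume_sepCone_pos ?_ ?_ ?_).ne' (hfin _ _) <;>
      simp [lorentz_geodesic]
  refine ⟨f 1, hpos, fun x y => ?_⟩
  have h1 := one_le_neg_lorentz x.2.1 x.2.2 y.2.1 y.2.2
  have hd : 0 ≤ hypDist x y := Real.arcosh_nonneg h1
  have hc : Real.cosh (hypDist x y) = -lorentz x.1 y.1 := Real.cosh_arcosh h1
  rw [volume_sepCone_congr x.2.1 y.2.1 (lorentz_geodesic_self m 0)
    (lorentz_geodesic_self m (hypDist x y)) (by rw [lorentz_geodesic, sub_zero, hc, neg_neg]),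
    mul_comm, ← eq_mul_of_additive (f := f) (fun _ _ => ENNReal.toReal_nonneg) hadd hd,
    ENNReal.ofReal_toReal (hfin _ _)]

/-! ### De Sitter volume as Lebesgue volume of a cone -/

/-- Integration in polar coordinates. -/
theorem lintegral_euclidean_polar (hn : 1 ≤ n) {g : EuclideanSpace ℝ (Fin n) → ℝ≥0∞}
    (hg : Measurable g) :
    ∫⁻ z, g z = ∫⁻ ω, (∫⁻ ρ in Set.Ioi (0 : ℝ), ENNReal.ofReal (ρ ^ (n - 1)) * g (ρ • ω.1))
      ∂(volume : Measure (EuclideanSpace ℝ (Fin n))).toSphere := by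
  have : Nonempty (Fin n) := ⟨⟨0, hn⟩⟩
  have hpres :=
    (volume : Measure (EuclideanSpace ℝ (Fin n))).measurePreserving_homeomorphUnitSphereProd
  have hmul : Measurable fun p : Metric.sphere (0 : EuclideanSpace ℝ (Fin n)) 1 × Set.Ioi (0 : ℝ) =>
      g (p.2.1 • p.1.1) := hg.comp (by fun_prop)
  calc ∫⁻ z, g z = ∫⁻ z in ({0}ᶜ : Set (EuclideanSpace ℝ (Fin n))), g z := by
        rw [restrict_compl_singleton]
    _ = ∫⁻ z : ({0}ᶜ : Set (EuclideanSpace ℝ (Fin n))), g z ∂(volume.comap Subtype.val) :=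
        (lintegral_subtype_comap (measurableSet_singleton _).compl g).symm
    _ = ∫⁻ p, g (p.2.1 • p.1.1) ∂((volume : Measure (EuclideanSpace ℝ (Fin n))).toSphere.prod
          (.volumeIoiPow (n - 1))) := by
        have h := hpres.lintegral_comp hmul
        rw [finrank_euclideanSpace_fin] at h
        rw [← h]
        refine lintegral_congr fun z => ?_
        congr 1
        simp [homeomorphUnitSphereProd, smul_smul,
          mul_inv_cancel₀ (norm_ne_zero_iff.2 z.2)]
    _ = _ := by
        rw [lintegral_prod _ hmul.aemeasurable]
        refine lintegral_congr fun ω => ?_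
        have hρ : Measurable fun ρ : Set.Ioi (0 : ℝ) => g (ρ.1 • ω.1) := hg.comp (by fun_prop)
        refine (lintegral_withDensity_eq_lintegral_mul _ (by fun_prop) hρ).trans ?_
        exact lintegral_subtype_comap measurableSet_Ioi
          fun ρ : ℝ => ENNReal.ofReal (ρ ^ (n - 1)) * g (ρ • ω.1)

/-- Fubini for `ℝⁿ⁺¹ = ℝ × ℝⁿ`. -/
theorem volume_eq_lintegral_euclidean {E : Set (Fin (n + 1) → ℝ)} (hE : MeasurableSet E) :
    Measurable (fun z : EuclideanSpace ℝ (Fin n) =>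
        volume {t : ℝ | (Fin.cons t (fun i => z i) : Fin (n + 1) → ℝ) ∈ E}) ∧
      volume E = ∫⁻ z : EuclideanSpace ℝ (Fin n),
        volume {t : ℝ | (Fin.cons t (fun i => z i) : Fin (n + 1) → ℝ) ∈ E} := by
  set e := MeasurableEquiv.piFinSuccAbove (fun _ : Fin (n + 1) => ℝ) 0
  have he : ∀ t (z : Fin n → ℝ), e.symm (t, z) = Fin.cons t z := fun t z => by
    simp [e, MeasurableEquiv.piFinSuccAbove, Fin.insertNthEquiv]
  have hm : MeasurableSet (e.symm ⁻¹' E) := e.symm.measurable hE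
  have hvol : volume E = volume (e.symm ⁻¹' E) :=
    (((volume_preserving_piFinSuccAbove (fun _ : Fin (n + 1) => ℝ) 0).symm).measure_preimage
      hE.nullMeasurableSet).symm
  have hset : ∀ z : Fin n → ℝ, (fun t => (t, z)) ⁻¹' (e.symm ⁻¹' E)
      = {t : ℝ | (Fin.cons t z : Fin (n + 1) → ℝ) ∈ E} := fun z => by
    ext t; simp [he]
  have hmeas : Measurable fun z : Fin n → ℝ =>
      volume {t : ℝ | (Fin.cons t z : Fin (n + 1) → ℝ) ∈ E} := by
    simpa only [hset] using measurable_measure_prodMk_right (μ := (volume : Measure ℝ)) hm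
  refine ⟨hmeas.comp (MeasurableEquiv.toLp 2 (Fin n → ℝ)).symm.measurable, ?_⟩
  rw [hvol, Measure.volume_eq_prod, Measure.prod_apply_symm hm]
  simp only [hset]
  exact ((EuclideanSpace.volume_preserving_symm_measurableEquiv_toLp (Fin n)).lintegral_comp
    hmeas).symm

theorem hasDerivAt_tanh (r : ℝ) : HasDerivAt Real.tanh (1 / Real.cosh r ^ 2) r := by
  have h := (Real.hasDerivAt_sinh r).div (Real.hasDerivAt_cosh r) (Real.cosh_pos r).ne'
  have e : Real.tanh = fun x => Real.sinh x / Real.cosh x := funext Real.tanh_eq_sinh_div_cosh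
  rw [e]
  convert! h using 1
  rw [← Real.cosh_sq_sub_sinh_sq r]; ring

/-- The substitution `t = ρ tanh r`. -/
theorem volume_eq_lintegral_tanh {ρ : ℝ} (hρ : 0 < ρ) {T : Set ℝ} (hT : MeasurableSet T)
    (hsub : T ⊆ Set.Ioo (-ρ) ρ) :
    volume T = ∫⁻ r, ENNReal.ofReal (ρ / Real.cosh r ^ 2) *
      T.indicator 1 (ρ * Real.tanh r) := by
  have himage : (fun r => ρ * Real.tanh r) '' Set.univ = Set.Ioo (-ρ) ρ := by
    ext t
    constructor
    · rintro ⟨r, -, rfl⟩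
      constructor <;> nlinarith [Real.tanh_lt_one r, Real.neg_one_lt_tanh r]
    · rintro ⟨h1, h2⟩
      refine ⟨Real.artanh (t / ρ), trivial, ?_⟩
      change ρ * Real.tanh _ = t
      rw [Real.tanh_artanh ⟨by rw [lt_div_iff₀ hρ]; linarith, by rw [div_lt_iff₀ hρ]; linarith⟩]
      field_simp
  have h := lintegral_image_eq_lintegral_abs_deriv_mul (f := fun r => ρ * Real.tanh r)
    (f' := fun r => ρ * (1 / Real.cosh r ^ 2)) MeasurableSet.univ
    (fun r _ => ((hasDerivAt_tanh r).const_mul ρ).hasDerivWithinAt)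
    (fun a _ b _ hab => Real.tanh_injective (mul_left_cancel₀ hρ.ne' hab)) (T.indicator 1)
  rw [himage, lintegral_indicator_one hT, Measure.restrict_apply hT,
    Set.inter_eq_left.2 hsub, Measure.restrict_univ] at h
  rw [h]
  refine lintegral_congr fun r => ?_
  have := Real.cosh_pos r
  rw [abs_of_nonneg (by positivity), mul_one_div]

/-- The radial integral: the density `ρⁿ⁻¹ · ρ / cosh² r` on `0 < ρ < cosh r` has total mass
`coshⁿ⁻¹ r / (n + 1)`. -/
theorem lintegral_radial (hn : 1 ≤ n) (r : ℝ) :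
    ∫⁻ ρ in Set.Ioi (0 : ℝ), ENNReal.ofReal (ρ ^ (n - 1)) *
        (ENNReal.ofReal (ρ / Real.cosh r ^ 2) * (Set.Iio (Real.cosh r)).indicator 1 ρ)
      = ENNReal.ofReal (Real.cosh r ^ (n - 1) / (n + 1)) := by
  have hc := Real.cosh_pos r
  calc _ = ∫⁻ ρ in Set.Ioi (0 : ℝ), (Set.Iio (Real.cosh r)).indicator
          (fun ρ => ENNReal.ofReal (ρ ^ n / Real.cosh r ^ 2)) ρ := by
        refine setLIntegral_congr_fun measurableSet_Ioi fun ρ hρ => ?_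
        have hρ : 0 < ρ := hρ
        by_cases h : ρ ∈ Set.Iio (Real.cosh r)
        · simp only [Set.indicator_of_mem h, Pi.one_apply, mul_one]
          rw [← ENNReal.ofReal_mul (by positivity), ← mul_div_assoc, ← pow_succ,
            Nat.sub_add_cancel hn]
        · simp [Set.indicator_of_notMem h]
    _ = ∫⁻ ρ in Set.Ioc 0 (Real.cosh r), ENNReal.ofReal (ρ ^ n / Real.cosh r ^ 2) := by
        rw [lintegral_indicator measurableSet_Iio, Measure.restrict_restrict measurableSet_Iio,
          Set.Iio_inter_Ioi, restrict_Ioo_eq_restrict_Ioc]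
    _ = ENNReal.ofReal (∫ ρ in (0 : ℝ)..Real.cosh r, ρ ^ n / Real.cosh r ^ 2) := by
        rw [intervalIntegral.integral_of_le hc.le, ofReal_integral_eq_lintegral_ofReal]
        · exact (Continuous.intervalIntegrable (by fun_prop) _ _).1
        · filter_upwards [ae_restrict_mem measurableSet_Ioc] with ρ hρ
          have := hρ.1
          exact div_nonneg (pow_nonneg this.le _) (sq_nonneg _)
    _ = _ := by
        rw [intervalIntegral.integral_div, integral_pow]
        congr 1
        obtain ⟨m, rfl⟩ : ∃ m, n = m + 1 := ⟨n - 1, by omega⟩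
        simp only [Nat.add_sub_cancel]
        field_simp
        ring

theorem measurable_polar : Measurable (polar (n := n)) := by
  refine Measurable.subtype_mk (measurable_pi_lambda _ fun i => ?_)
  refine Fin.cases ?_ (fun j => ?_) i
  · simp only [Fin.cons_zero]
    fun_prop
  · simp only [Fin.cons_succ]
    fun_prop

/-- The points `(t, ρω)` of the solid de Sitter cone over a conic set `B`, in terms of `r` with
`t = ρ tanh r`: the point is `(ρ / cosh r) • polar (r, ω)`. -/
theorem cons_tanh_mem_iff {B : Set (Fin (n + 1) → ℝ)}
    (hcone : ∀ s : ℝ, 0 < s → ∀ v, s • v ∈ B ↔ v ∈ B) {ρ : ℝ} (hρ : 0 < ρ) (r : ℝ)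
    (ω : Metric.sphere (0 : EuclideanSpace ℝ (Fin n)) 1) :
    (Fin.cons (ρ * Real.tanh r) (fun i => (ρ • ω.1) i) : Fin (n + 1) → ℝ) ∈
        {v | (0 < lorentz v v ∧ lorentz v v < 1) ∧ v ∈ B}
      ↔ (polar (r, ω)).1 ∈ B ∧ ρ < Real.cosh r := by
  have hc := Real.cosh_pos r
  have he : (Fin.cons (ρ * Real.tanh r) (fun i => (ρ • ω.1) i) : Fin (n + 1) → ℝ)
      = (ρ / Real.cosh r) • (polar (r, ω)).1 := by
    ext i
    refine Fin.cases ?_ (fun j => ?_) i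
    · simp [polar, Real.tanh_eq_sinh_div_cosh]; ring
    · simp [polar]; field_simp
  have hpos : 0 < ρ / Real.cosh r := by positivity
  rw [he, Set.mem_ofPred_eq, hcone _ hpos, lorentz_smul_left, lorentz_smul_right,
    (polar (r, ω)).2, mul_one, and_comm]
  refine and_congr_right fun _ => ?_
  rw [← div_lt_one hc]
  constructor
  · rintro ⟨-, h⟩
    nlinarith
  · intro h
    exact ⟨by positivity, by nlinarith⟩

/-- The de Sitter volume of a set is `n + 1` times the Lebesgue volume of the cone from the
origin over it. -/
theorem deSitterMeasure_eq_volume_cone (hn : 1 ≤ n) {B : Set (Fin (n + 1) → ℝ)}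
    (hB : MeasurableSet B) (hcone : ∀ s : ℝ, 0 < s → ∀ v, s • v ∈ B ↔ v ∈ B) :
    deSitterMeasure n {u | u.1 ∈ B}
      = (n + 1) * volume {v | (0 < lorentz v v ∧ lorentz v v < 1) ∧ v ∈ B} := by
  set E : Set (Fin (n + 1) → ℝ) := {v | (0 < lorentz v v ∧ lorentz v v < 1) ∧ v ∈ B} with hE
  have hq : Measurable fun v : Fin (n + 1) → ℝ => lorentz v v := continuous_lorentz_self.measurable
  have hEm : MeasurableSet E :=
    ((measurableSet_lt measurable_const hq).inter (measurableSet_lt hq measurable_const)).inter hB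
  have hBm : MeasurableSet {u : DeSitter n | u.1 ∈ B} := measurable_subtype_coe hB
  have hPm : MeasurableSet (polar ⁻¹' {u : DeSitter n | u.1 ∈ B}) := measurable_polar hBm
  obtain ⟨hgm, hvol⟩ := volume_eq_lintegral_euclidean hEm
  rw [hvol, lintegral_euclidean_polar hn hgm, deSitterMeasure,
    Measure.map_apply measurable_polar hBm, Measure.prod_apply_symm hPm,
    ← lintegral_const_mul' _ _ (by finiteness)]
  refine lintegral_congr fun ω => ?_
  set A : Set ℝ := (fun r => (r, ω)) ⁻¹' (polar ⁻¹' {u : DeSitter n | u.1 ∈ B}) with hA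
  have hAm : MeasurableSet A := (by fun_prop : Measurable fun r : ℝ => (r, ω)) hPm
  have hinner : ∀ ρ ∈ Set.Ioi (0 : ℝ),
      ENNReal.ofReal (ρ ^ (n - 1)) *
        volume {t : ℝ | (Fin.cons t (fun i => (ρ • ω.1) i) : Fin (n + 1) → ℝ) ∈ E}
      = ∫⁻ r in A, ENNReal.ofReal (ρ ^ (n - 1)) *
          (ENNReal.ofReal (ρ / Real.cosh r ^ 2) * (Set.Iio (Real.cosh r)).indicator 1 ρ) := by
    intro ρ hρ
    have hρ : 0 < ρ := hρ
    set T : Set ℝ := {t | (Fin.cons t (fun i => (ρ • ω.1) i) : Fin (n + 1) → ℝ) ∈ E}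
    have hTm : MeasurableSet T := by
      refine (measurable_pi_lambda _ fun i => ?_ :
        Measurable fun t : ℝ => (Fin.cons t (fun i => (ρ • ω.1) i) : Fin (n + 1) → ℝ)) hEm
      refine Fin.cases ?_ (fun j => ?_) i
      · simp only [Fin.cons_zero]; fun_prop
      · simp only [Fin.cons_succ]; fun_prop
    have hsub : T ⊆ Set.Ioo (-ρ) ρ := by
      rintro t ⟨⟨h, -⟩, -⟩
      have h1 : ‖ω.1‖ ^ 2 = 1 := by rw [mem_sphere_zero_iff_norm.1 ω.2]; norm_num
      rw [EuclideanSpace.real_norm_sq_eq] at h1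
      have h2 : ∑ i : Fin n, (ρ • ω.1) i * (ρ • ω.1) i = ρ ^ 2 * ∑ i : Fin n, ω.1 i ^ 2 := by
        rw [Finset.mul_sum]
        exact Finset.sum_congr rfl fun i _ => by simp; ring
      simp only [lorentz, Fin.cons_zero, Fin.cons_succ, h2, h1] at h
      exact abs_lt.1 (abs_lt_of_sq_lt_sq (by linarith) hρ.le)
    have hiff : ∀ r, ρ * Real.tanh r ∈ T ↔ r ∈ A ∧ ρ < Real.cosh r :=
      fun r => cons_tanh_mem_iff hcone hρ r ω
    rw [volume_eq_lintegral_tanh hρ hTm hsub, lintegral_const_mul' _ _ ENNReal.ofReal_ne_top,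
      ← lintegral_indicator hAm]
    congr 1
    refine lintegral_congr fun r => ?_
    by_cases h1 : r ∈ A <;> by_cases h2 : ρ < Real.cosh r <;>
      simp [Set.indicator, hiff, h1, h2]
  have hmeas : Measurable (Function.uncurry fun (ρ r : ℝ) => ENNReal.ofReal (ρ ^ (n - 1)) *
      (ENNReal.ofReal (ρ / Real.cosh r ^ 2) *
        (Set.Iio (Real.cosh r)).indicator (1 : ℝ → ℝ≥0∞) ρ)) := by
    refine Measurable.mul (by fun_prop) (Measurable.mul (by fun_prop) ?_)
    exact (measurable_const (a := (1 : ℝ≥0∞))).indicator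
      (measurableSet_lt measurable_fst (by fun_prop :
        Measurable fun p : ℝ × ℝ => Real.cosh p.2))
  rw [withDensity_apply _ hAm, setLIntegral_congr_fun measurableSet_Ioi hinner,
    lintegral_lintegral_swap hmeas.aemeasurable, ← lintegral_const_mul' _ _ (by finiteness)]
  refine lintegral_congr fun r => ?_
  rw [lintegral_radial hn, ENNReal.ofReal_div_of_pos (by positivity)]
  have hn1 : ENNReal.ofReal ((n : ℝ) + 1) = n + 1 := by
    rw [ENNReal.ofReal_add (by positivity) zero_le_one]; simp
  rw [hn1, ENNReal.mul_div_cancel (by positivity) (by finiteness)]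

/-! ### Hyperplanes and separation -/

theorem measurable_toHyperplane : Measurable (toHyperplane (n := n)) := fun _ h => h

/-- If `P_u = P_u'` separates `x` and `y` by means of `u'`, then also by means of `u`: the two
linear forms vanish at the same point of the segment from `x` to `y`. -/
theorem lorentz_mul_lorentz_neg_of_perp_eq {u u' : DeSitter n} (h : perp u' = perp u)
    {x y : Hyperboloid n} (hx : lorentz x.1 u'.1 < 0) (hy : 0 < lorentz y.1 u'.1) :
    lorentz x.1 u.1 * lorentz y.1 u.1 < 0 := by
  set a := lorentz y.1 u'.1
  set b := -lorentz x.1 u'.1 with hb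
  have hb0 : 0 < b := by linarith
  set z := a • x.1 + b • y.1 with hz
  have hxy := one_le_neg_lorentz x.2.1 x.2.2 y.2.1 y.2.2
  have hzz : lorentz z z < 0 := by
    simp only [hz, lorentz_add_left, lorentz_add_right, lorentz_smul_left, lorentz_smul_right,
      x.2.1, y.2.1, lorentz_comm y.1 x.1]
    nlinarith [mul_pos hy hb0]
  have hz0 : 0 < z 0 := by
    simp only [hz, Pi.add_apply, Pi.smul_apply, smul_eq_mul]
    have := x.2.2
    have := y.2.2
    positivity
  have hs : 0 < √(-lorentz z z) := Real.sqrt_pos.2 (by linarith)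
  have hss : √(-lorentz z z) ^ 2 = -lorentz z z := Real.sq_sqrt (by linarith)
  let p : Hyperboloid n := ⟨(√(-lorentz z z))⁻¹ • z, by
    rw [lorentz_smul_left, lorentz_smul_right]
    field_simp
    linarith, by
    simp only [Pi.smul_apply, smul_eq_mul]
    positivity⟩
  have hp' : p ∈ perp u' := by
    change lorentz (_ • z) _ = 0
    simp only [lorentz_smul_left, hz, lorentz_add_left, hb, a]
    ring
  have hp : lorentz (_ • z) u.1 = 0 := h ▸ hp'
  rw [lorentz_smul_left, mul_eq_zero_iff_left (inv_pos.2 hs).ne', hz, lorentz_add_left,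
    lorentz_smul_left, lorentz_smul_left] at hp
  have hx0 : lorentz x.1 u.1 ≠ 0 := fun h0 => by
    have : x ∈ perp u' := h ▸ h0
    exact hx.ne this
  rcases hx0.lt_or_gt with h0 | h0
  · exact mul_neg_of_neg_of_pos h0 (by by_contra! h1; nlinarith)
  · exact mul_neg_of_pos_of_neg h0 (by by_contra! h1; nlinarith)

theorem separates_toHyperplane_iff (u : DeSitter n) (x y : Hyperboloid n) :
    Separates (toHyperplane u) x y ↔ lorentz x.1 u.1 * lorentz y.1 u.1 < 0 := by
  constructor
  · rintro ⟨u', h, hx, hy⟩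
    exact lorentz_mul_lorentz_neg_of_perp_eq (congrArg Subtype.val h) hx hy
  · intro h
    rcases mul_neg_iff.1 h with ⟨hx, hy⟩ | ⟨hx, hy⟩
    · have hneg : ∀ v, lorentz v ((-1 : ℝ) • u.1) = -lorentz v u.1 := fun v => by
        rw [lorentz_smul_right]; ring
      refine ⟨⟨(-1 : ℝ) • u.1, by rw [hneg, lorentz_smul_left, u.2]; ring⟩, ?_, ?_, ?_⟩
      · refine Subtype.ext (Set.ext fun z => ?_)
        change lorentz z.1 ((-1 : ℝ) • u.1) = 0 ↔ lorentz z.1 u.1 = 0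
        rw [hneg, neg_eq_zero]
      · change lorentz x.1 ((-1 : ℝ) • u.1) < 0
        rw [hneg]; linarith
      · change 0 < lorentz y.1 ((-1 : ℝ) • u.1)
        rw [hneg]; linarith
    · exact ⟨u, rfl, hx, hy⟩

theorem measurableSet_lorentz_mul_neg (x y : Fin (n + 1) → ℝ) :
    MeasurableSet {v | lorentz x v * lorentz y v < 0} :=
  (isOpen_lt ((continuous_lorentz x).mul (continuous_lorentz y)) continuous_const).measurableSet

theorem toHyperplane_preimage_separates (x y : Hyperboloid n) :
    toHyperplane ⁻¹' {H | Separates H x y}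
      = {u : DeSitter n | u.1 ∈ {v | lorentz x.1 v * lorentz y.1 v < 0}} := by
  ext u
  exact separates_toHyperplane_iff u x y

theorem measurableSet_separates (x y : Hyperboloid n) :
    MeasurableSet {H : Hyperplane n | Separates H x y} := by
  change MeasurableSet (toHyperplane ⁻¹' {H | Separates H x y})
  rw [toHyperplane_preimage_separates]
  exact measurable_subtype_coe (measurableSet_lorentz_mul_neg _ _)

theorem hyperplaneMeasure_separates (hn : 1 ≤ n) (x y : Hyperboloid n) :
    hyperplaneMeasure n {H | Separates H x y} = (n + 1) * volume (sepCone x.1 y.1) := by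
  rw [hyperplaneMeasure, Measure.map_apply measurable_toHyperplane (measurableSet_separates x y),
    toHyperplane_preimage_separates,
    deSitterMeasure_eq_volume_cone hn (measurableSet_lorentz_mul_neg _ _)]
  · rfl
  · intro s hs v
    have : s * lorentz x.1 v * (s * lorentz y.1 v)
        = s * s * (lorentz x.1 v * lorentz y.1 v) := by ring
    simp only [Set.mem_ofPred_eq, lorentz_smul_right, this]
    exact smul_neg_iff_of_pos_left (mul_pos hs hs)

theorem ae_notMem_hyperplane (hn : 1 ≤ n) (x : Hyperboloid n) :
    ∀ᵐ H ∂hyperplaneMeasure n, x ∉ H.1 := by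
  have hB : MeasurableSet {v : Fin (n + 1) → ℝ | lorentz x.1 v = 0} :=
    (isClosed_eq (continuous_lorentz _) continuous_const).measurableSet
  have hpre : toHyperplane ⁻¹' {H : Hyperplane n | x ∈ H.1}
      = {u : DeSitter n | u.1 ∈ {v : Fin (n + 1) → ℝ | lorentz x.1 v = 0}} := rfl
  have hm : MeasurableSet {H : Hyperplane n | x ∈ H.1} := by
    change MeasurableSet (toHyperplane ⁻¹' {H | x ∈ H.1})
    rw [hpre]
    exact measurable_subtype_coe hB
  rw [ae_iff]
  simp only [not_not]
  rw [hyperplaneMeasure, Measure.map_apply measurable_toHyperplane hm, hpre,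
    deSitterMeasure_eq_volume_cone hn hB, measure_mono_null (fun _ h => h.2)
      (volume_lorentz_eq_zero x.2.1), mul_zero]
  intro s hs v
  simp [lorentz_smul_right, hs.ne']

/-- The Crofton formula: suitably normalized, the measure of the hyperplanes separating two
points is their distance. -/
theorem exists_smul_hyperplaneMeasure_separates_eq (hn : 1 ≤ n) :
    ∃ c : ℝ≥0, 0 < c ∧ ∀ x y : Hyperboloid n,
      (c • hyperplaneMeasure n) {H | Separates H x y} = ENNReal.ofReal (hypDist x y) := by
  obtain ⟨C, hC, h⟩ := exists_volume_sepCone_eq hn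
  have hpos : 0 < ((n + 1) * C)⁻¹ := by positivity
  refine ⟨Real.toNNReal ((n + 1) * C)⁻¹, Real.toNNReal_pos.2 hpos, fun x y => ?_⟩
  have hn1 : (n + 1 : ℝ≥0∞) = ENNReal.ofReal ((n : ℝ) + 1) := by
    rw [ENNReal.ofReal_add (by positivity) zero_le_one]; simp
  rw [Measure.smul_apply, hyperplaneMeasure_separates hn, h, hn1,
    ← ENNReal.ofReal_mul (by positivity), ENNReal.smul_def, smul_eq_mul]
  change ENNReal.ofReal _ * _ = _
  rw [← ENNReal.ofReal_mul hpos.le]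
  congr 1
  field_simp

/-! ### The wall map -/

theorem wallMap_eq_indicator (o x : Hyperboloid n) :
    wallMap o x = {H | Separates H x o}.indicator fun _ => (1 : ℝ) := by
  ext H
  simp [wallMap, Set.indicator]

/-- A hyperplane missing `o`, `x` and `y` separates `x` and `y` if and only if it separates
exactly one of them from `o`. -/
theorem norm_wallMap_sub_wallMap {o x y : Hyperboloid n} {H : Hyperplane n} (ho : o ∉ H.1)
    (hx : x ∉ H.1) (hy : y ∉ H.1) :
    ‖wallMap o x H - wallMap o y H‖
      = ‖{H | Separates H x y}.indicator (fun _ => (1 : ℝ)) H‖ := by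
  by_cases hH : ∃ u, toHyperplane u = H
  · obtain ⟨u, rfl⟩ := hH
    have ho : lorentz o.1 u.1 ≠ 0 := ho
    have hx : lorentz x.1 u.1 ≠ 0 := hx
    have hy : lorentz y.1 u.1 ≠ 0 := hy
    simp only [wallMap, Set.indicator, Set.mem_ofPred_eq, separates_toHyperplane_iff]
    rcases ho.lt_or_gt with ho | ho <;> rcases hx.lt_or_gt with hx | hx <;>
    rcases hy.lt_or_gt with hy | hy <;>
      simp [mul_neg_iff, ho, hx, hy, ho.not_gt, hx.not_gt, hy.not_gt]
  · have : ∀ a b, ¬Separates H a b := fun a b ⟨u, hu, _⟩ => hH ⟨u, hu⟩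
    simp [wallMap, this]

theorem norm_toLp_wallMap_sub_sq (hn : 1 ≤ n) {c : ℝ≥0} {o x y : Hyperboloid n}
    (hx : MemLp (wallMap o x) 2 (c • hyperplaneMeasure n))
    (hy : MemLp (wallMap o y) 2 (c • hyperplaneMeasure n)) :
    ‖hx.toLp (wallMap o x) - hy.toLp (wallMap o y)‖ ^ 2
      = (c • hyperplaneMeasure n).real {H | Separates H x y} := by
  have hae : ∀ z : Hyperboloid n, ∀ᵐ H ∂(c • hyperplaneMeasure n), z ∉ H.1 := fun z =>
    Measure.ae_smul_measure (ae_notMem_hyperplane hn z) c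
  have hcongr : eLpNorm (wallMap o x - wallMap o y) 2 (c • hyperplaneMeasure n)
      = eLpNorm ({H | Separates H x y}.indicator fun _ => (1 : ℝ)) 2
          (c • hyperplaneMeasure n) := by
    refine eLpNorm_congr_norm_ae ?_
    filter_upwards [hae o, hae x, hae y] with H h1 h2 h3
    exact norm_wallMap_sub_wallMap h1 h2 h3
  rw [← MemLp.toLp_sub, Lp.norm_toLp, hcongr,
    eLpNorm_indicator_const (measurableSet_separates x y) two_ne_zero ENNReal.ofNat_ne_top]
  simp only [enorm_one, one_mul, ENNReal.toReal_ofNat]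
  rw [← ENNReal.toReal_pow, ← ENNReal.rpow_natCast, ← ENNReal.rpow_mul]
  norm_num [Measure.real]

/-- A kernel of the form `‖φ v - φ w‖ ^ 2` is conditionally negative. -/
theorem isCondNegKernel_of_norm_sub_sq {V E : Type*} [NormedAddCommGroup E]
    [InnerProductSpace ℝ E] {f : V → V → ℝ} (φ : V → E) (h : ∀ v w, f v w = ‖φ v - φ w‖ ^ 2) :
    IsCondNegKernel f := by
  intro s a ha
  have key := inner_sum_smul_sum_smul_of_sum_eq_zero φ ha φ ha
  have hnn := real_inner_self_nonneg (F := E) (x := ∑ i ∈ s, a i • φ i)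
  simp only [h, sq]
  linarith

end HypWalls

theorem mainTheorem2 (n : ℕ) (hn : 1 ≤ n) :
    HypWalls.IsCondNegKernel (HypWalls.hypDist (n := n)) ∧
    ∃ c : ℝ≥0, 0 < c ∧
      ∀ o : HypWalls.Hyperboloid n,
        ∃ hΦ : ∀ x : HypWalls.Hyperboloid n,
            MemLp (HypWalls.wallMap o x) 2 (c • HypWalls.hyperplaneMeasure n),
          ∀ x y : HypWalls.Hyperboloid n,
            ENNReal.ofReal (‖(hΦ x).toLp (HypWalls.wallMap o x)
                - (hΦ y).toLp (HypWalls.wallMap o y)‖ ^ 2)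
              = (c • HypWalls.hyperplaneMeasure n) {H | HypWalls.Separates H x y} ∧
            HypWalls.hypDist x y
              = ‖(hΦ x).toLp (HypWalls.wallMap o x)
                - (hΦ y).toLp (HypWalls.wallMap o y)‖ ^ 2 := by
  open HypWalls in
  obtain ⟨c, hc, hsep⟩ := exists_smul_hyperplaneMeasure_separates_eq hn
  have hfin : ∀ x y : Hyperboloid n,
      (c • hyperplaneMeasure n) {H | Separates H x y} ≠ ∞ := fun x y => by
    rw [hsep]; exact ENNReal.ofReal_ne_top
  have hΦ : ∀ o x : Hyperboloid n, MemLp (wallMap o x) 2 (c • hyperplaneMeasure n) :=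
    fun o x => by
      rw [wallMap_eq_indicator]
      exact memLp_indicator_const 2 (measurableSet_separates x o) 1 (.inr (hfin x o))
  have hdist : ∀ o x y : Hyperboloid n, hypDist x y
      = ‖(hΦ o x).toLp (wallMap o x) - (hΦ o y).toLp (wallMap o y)‖ ^ 2 := fun o x y => by
    have hd : 0 ≤ hypDist x y :=
      Real.arcosh_nonneg (one_le_neg_lorentz x.2.1 x.2.2 y.2.1 y.2.2)
    rw [norm_toLp_wallMap_sub_sq hn, Measure.real, hsep, ENNReal.toReal_ofReal hd]
  refine ⟨?_, c, hc, fun o => ⟨hΦ o, fun x y => ⟨?_, hdist o x y⟩⟩⟩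
  · rcases isEmpty_or_nonempty (Hyperboloid n) with h | ⟨⟨o⟩⟩
    · intro s a _
      simp [Finset.eq_empty_of_isEmpty s]
    · exact isCondNegKernel_of_norm_sub_sq (fun x => (hΦ o x).toLp (wallMap o x)) (hdist o)
  · rw [norm_toLp_wallMap_sub_sq hn, ofReal_measureReal (hfin x y)]
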